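/- Let $H, X, Y, Z$ be real Hilbert spaces (of possibly infinite dimension), let $Q:H\to Z$, $R:H\to X$, $S:H\to Y$ be bounded linear maps, let $\Lambda:H\to\mathbb{R}^m$ be a surjective bounded linear map, and set $\mathcal N=\ker\Lambda$. Assume that there is $\delta>0$ such that $\max\{\|Rh\|,\|Sh\|\}\ge\delta\|h\|$ for all $h\in\mathcal N$ (when $H$ is finite-dimensional, this says exactly that $\ker R\cap\ker S\cap\ker\Lambda=\{0\}$). Let $\mathcal K=\{f\in H:\|Rf\|\le1 \text{ and } \|Sf\|\le1\}$ and let $$\mathrm{Err}^*=\inf_{\Delta:\mathbb{R}^m\to Z}\ \sup_{f\in\mathcal K}\|Qf-\Delta(\Lambda f)\|$$ be the radius of information, the infimum being over all maps $\Delta$. Write $Q_{\mathcal N},R_{\mathcal N},S_{\mathcal N}$ for the restrictions of $Q,R,S$ to $\mathcal N$ and, for a bounded self-adjoint operator $A$, write $\lambda_{\max}(A)$ for the largest element of its spectrum (its largest eigenvalue in finite dimension; $0$ on the zero space). Let $D$ be the set of those $\tau\in[0,1]$ for which $T_\tau=(1-\tau)R_{\mathcal N}^*R_{\mathcal N}+\tau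 S_{\mathcal N}^*S_{\mathcal N}$ has a bounded inverse, and for $\tau\in D$ let $$g(\tau)=\lambda_{\max}\big(Q_{\mathcal N}\,T_\tau^{-1}\,Q_{\mathcal N}^*\big).$$ Then $(0,1)\subseteq D$, and the square of the radius of information is the finite number $$(\mathrm{Err}^*)^2=\lambda_\sharp:=\inf_{\tau\in D}\,g(\tau),$$ the infimum being a minimum whenever $D=[0,1]$. Moreover, if $\tau_\sharp\in(0,1)$ minimizes $g$ over $D$, then $a_\sharp=(1-\tau_\sharp)\lambda_\sharp$ and $b_\sharp=\tau_\sharp\lambda_\sharp$ are minimizers of the program $$\text{minimize } a+b \text{ over } a,b\ge0\quad\text{subject to}\quad a\|Rh\|^2+b\|Sh\|^2\ge\|Qh\|^2\ \text{ for all } h\in\ker\Lambda .$$ -/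

import Mathlib

open Set
open scoped ENNReal InnerProductSpace

noncomputable section

namespace OptimalRecovery

variable {H X Y Z : Type*}
  [NormedAddCommGroup H] [InnerProductSpace ℝ H]
  [NormedAddCommGroup X] [InnerProductSpace ℝ X]
  [NormedAddCommGroup Y] [InnerProductSpace ℝ Y]
  [NormedAddCommGroup Z] [InnerProductSpace ℝ Z]
  {m : ℕ}

/-- The model set: the intersection of the two centered hyperellipsoids
`‖R f‖ ≤ 1` and `‖S f‖ ≤ 1`. -/
def modelSet (R : H →L[ℝ] X) (S : H →L[ℝ] Y) : Set H :=
  {f | ‖R f‖ ≤ 1 ∧ ‖S f‖ ≤ 1}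

/-- The global worst-case error over the set `K` of the (arbitrary, possibly nonlinear)
recovery map `Δ` for the estimation of `Q` from the observations `Λ f`, with values in `[0, ∞]`. -/
def worstCaseError (Q : H →L[ℝ] Z) (K : Set H) (Λ : H →L[ℝ] EuclideanSpace ℝ (Fin m))
    (Δ : EuclideanSpace ℝ (Fin m) → Z) : ℝ≥0∞ :=
  ⨆ f ∈ K, ENNReal.ofReal ‖Q f - Δ (Λ f)‖

/-- The radius of information: the infimum of the worst-case errors over all recovery maps. -/
def radius (Q : H →L[ℝ] Z) (K : Set H) (Λ : H →L[ℝ] EuclideanSpace ℝ (Fin m)) : ℝ≥0∞ :=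
  ⨅ Δ : EuclideanSpace ℝ (Fin m) → Z, worstCaseError Q K Λ Δ

/-- The pairs `(a, b)` with `a, b ≥ 0` and `a ‖R h‖² + b ‖S h‖² ≥ ‖Q h‖²` for all `h ∈ ker Λ`. -/
def feasibleSet (Q : H →L[ℝ] Z) (R : H →L[ℝ] X) (S : H →L[ℝ] Y)
    (Λ : H →L[ℝ] EuclideanSpace ℝ (Fin m)) : Set (ℝ × ℝ) :=
  {p | 0 ≤ p.1 ∧ 0 ≤ p.2 ∧
    ∀ h : H, Λ h = 0 → p.1 * ‖R h‖ ^ 2 + p.2 * ‖S h‖ ^ 2 ≥ ‖Q h‖ ^ 2}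

/-- The pair `(a, b)` is a minimizer of `a + b` over the feasible set. -/
def IsProgramMinimizer (Q : H →L[ℝ] Z) (R : H →L[ℝ] X) (S : H →L[ℝ] Y)
    (Λ : H →L[ℝ] EuclideanSpace ℝ (Fin m)) (a b : ℝ) : Prop :=
  (a, b) ∈ feasibleSet Q R S Λ ∧
    IsMinOn (fun p : ℝ × ℝ => p.1 + p.2) (feasibleSet Q R S Λ) (a, b)

/-- The null space `ker Λ` of the observation map. -/
abbrev nullSpace (Λ : H →L[ℝ] EuclideanSpace ℝ (Fin m)) : Submodule ℝ H :=
  LinearMap.ker (Λ : H →ₗ[ℝ] EuclideanSpace ℝ (Fin m))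

/-- The restriction to `ker Λ` of a bounded linear map defined on `H`. -/
def restrict (Λ : H →L[ℝ] EuclideanSpace ℝ (Fin m)) (A : H →L[ℝ] Z) : nullSpace Λ →L[ℝ] Z :=
  A ∘L (nullSpace Λ).subtypeL

/-- The largest element of the spectrum of a bounded self-adjoint operator
(its largest eigenvalue in finite dimension; by convention `0` on the zero space). -/
def lambdaMax (A : Z →L[ℝ] Z) : ℝ :=
  sSup (spectrum ℝ A)

variable [CompleteSpace H] [CompleteSpace X] [CompleteSpace Y] [CompleteSpace Z]

/-- The operator `(1 - τ) R_N^* R_N + τ S_N^* S_N` on `N = ker Λ`. -/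
def pencil (R : H →L[ℝ] X) (S : H →L[ℝ] Y) (Λ : H →L[ℝ] EuclideanSpace ℝ (Fin m)) (τ : ℝ) :
    nullSpace Λ →L[ℝ] nullSpace Λ :=
  (1 - τ) • ((restrict Λ R).adjoint ∘L restrict Λ R) + τ • ((restrict Λ S).adjoint ∘L restrict Λ S)

/-- The parameters `τ ∈ [0, 1]` at which `(1 - τ) R_N^* R_N + τ S_N^* S_N` has a bounded inverse,
i.e., those at which the objective below makes sense. -/
def domain (R : H →L[ℝ] X) (S : H →L[ℝ] Y) (Λ : H →L[ℝ] EuclideanSpace ℝ (Fin m)) : Set ℝ :=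
  {τ | τ ∈ Icc (0 : ℝ) 1 ∧ IsUnit (pencil R S Λ τ)}

/-- The objective `λ_max (Q_N [(1 - τ) R_N^* R_N + τ S_N^* S_N]⁻¹ Q_N^*)`. It is only
ever used for `τ` in `domain R S Λ`, where `Ring.inverse` is the true inverse. -/
def objective (Q : H →L[ℝ] Z) (R : H →L[ℝ] X) (S : H →L[ℝ] Y)
    (Λ : H →L[ℝ] EuclideanSpace ℝ (Fin m)) (τ : ℝ) : ℝ :=
  lambdaMax (restrict Λ Q ∘L Ring.inverse (pencil R S Λ τ) ∘L (restrict Λ Q).adjoint)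

end OptimalRecovery

end

/-!
The squared radius, the infimum of the objective and the value of the program all coincide with
`v`, the supremum of `‖Q h‖²` over the elements `h` of the model set that lie in `ker Λ`.

* Lower bound. If `h` is in the model set and in `ker Λ`, so is `-h`, and a recovery map has the
  single value `Δ 0` to offer for both, whence an error at least `‖Q h‖`
  (`ofReal_norm_le_radius`).
* Upper bound. For `τ` in the domain, every `f` splits as `u + k` with `k ∈ ker Λ` and `u`
  orthogonal to `ker Λ` for the semi-inner product `(1 - τ) ⟪R ·, R ·⟫ + τ ⟪S ·, S ·⟫`, and the
  recovery map `Λ f ↦ Q u` makes the error `‖Q k‖`. The objective at `τ` is the least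
  `c ≥ 0` such that `‖Q h‖² ≤ c ((1 - τ) ‖R h‖² + τ ‖S h‖²)` on `ker Λ` (`objective_le_iff`), so that
  by Pythagoras `‖Q k‖²` is at most the objective (`radius_sq_le_objective`).
* Duality. By homogeneity `‖Q h‖² ≤ v max (‖R h‖², ‖S h‖²)` on `ker Λ`. Of the two quadratic
  forms `v ‖R h‖² - ‖Q h‖²` and `v ‖S h‖² - ‖Q h‖²`, one is therefore nonnegative at each point,
  and Yuan's lemma (`exists_combination_nonneg_of_max_nonneg`), which holds in every dimension,
  provides one `t ∈ [0, 1]` with `‖Q h‖² ≤ v ((1 - t) ‖R h‖² + t ‖S h‖²)` throughout `ker Λ`. If `t`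
  is in the domain, the objective at `t` is `v`; otherwise `t` is an endpoint and nearby interior
  parameters have an objective close to `v` (`isGLB_objective`).
-/

namespace OptimalRecovery

/-! ### Yuan's alternative for two quadratic forms -/

/-- Two quadratic forms satisfying `0 ≤ max (F h) (G h)` everywhere have no common value of
`t ∈ [0, 1]` at which `(1 - t) F + t G` is negative both at a point where `F < 0` and at a point
where `G < 0`. After a change of sign of one of the points the combination is negative on the
whole segment joining them, which is then split into the disjoint open sets `F < 0` and
`G < 0`. -/
theorem not_combination_neg_of_max_nonneg {E : Type*} [AddCommGroup E] [Module ℝ E]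
    {F G : QuadraticForm ℝ E} (hFG : ∀ h, 0 ≤ max (F h) (G h)) {t : ℝ} (ht : t ∈ Icc (0 : ℝ) 1)
    {x y : E} (hx : (1 - t) * F x + t * G x < 0) (hFx : F x < 0)
    (hy : (1 - t) * F y + t * G y < 0) (hGy : G y < 0) : False := by
  set M : QuadraticForm ℝ E := (1 - t) • F + t • G with hM
  have hMv (h : E) : M h = (1 - t) * F h + t * G h := by simp [hM]
  wlog hp : QuadraticMap.polar M x y ≤ 0 generalizing y
  · refine this (y := -y) (by simpa using hy) (by simpa using hGy) ?_
    rw [QuadraticMap.polar_neg_right]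
    linarith [not_le.1 hp]
  have key (P : QuadraticForm ℝ E) (s : ℝ) : P ((1 - s) • x + s • y) =
      (1 - s) ^ 2 * P x + s ^ 2 * P y + (1 - s) * s * QuadraticMap.polar P x y := by
    rw [QuadraticMap.map_add P, QuadraticMap.map_smul, QuadraticMap.map_smul,
      QuadraticMap.polar_smul_left, QuadraticMap.polar_smul_right]
    simp only [smul_eq_mul]
    ring
  have hcont (P : QuadraticForm ℝ E) : Continuous fun s : ℝ => P ((1 - s) • x + s • y) := by
    simp only [key]
    fun_prop
  have hneg : ∀ s ∈ Icc (0 : ℝ) 1, M ((1 - s) • x + s • y) < 0 := by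
    rintro s ⟨hs0, hs1⟩
    rw [key]
    rw [← hMv] at hx hy
    have h3 : (1 - s) * s * QuadraticMap.polar M x y ≤ 0 :=
      mul_nonpos_of_nonneg_of_nonpos (mul_nonneg (by linarith) hs0) hp
    rcases hs0.eq_or_lt with rfl | hs
    · simpa using hx
    · nlinarith [mul_pos hs hs, mul_nonneg (sq_nonneg (1 - s)) (neg_nonneg.2 hx.le),
        mul_pos (mul_pos hs hs) (neg_pos.2 hy)]
  obtain ⟨s, -, hs1, hs2⟩ := isPreconnected_Icc (a := (0 : ℝ)) (b := 1)
    {s | F ((1 - s) • x + s • y) < 0} {s | G ((1 - s) • x + s • y) < 0}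
    (isOpen_lt (hcont F) continuous_const) (isOpen_lt (hcont G) continuous_const)
    (fun s hs => by
      by_contra hc
      simp only [mem_union, mem_ofPred_eq, not_or, not_lt] at hc
      have h1 := hneg s hs
      rw [hMv] at h1
      nlinarith [mul_nonneg (sub_nonneg.2 ht.2) hc.1, mul_nonneg ht.1 hc.2])
    ⟨0, by simp, by simpa using hFx⟩ ⟨1, by simp, by simpa using hGy⟩
  exact (hFG _).not_gt (max_lt hs1 hs2)

/-- **Yuan's lemma**: if at every point one of two quadratic forms on a real vector space is
nonnegative, then some convex combination of the two forms is nonnegative everywhere. -/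
theorem exists_combination_nonneg_of_max_nonneg {E : Type*} [AddCommGroup E] [Module ℝ E]
    {F G : QuadraticForm ℝ E} (hFG : ∀ h, 0 ≤ max (F h) (G h)) :
    ∃ t ∈ Icc (0 : ℝ) 1, ∀ h, 0 ≤ (1 - t) * F h + t * G h := by
  by_contra! hcon
  have hopen (p : E → Prop) : IsOpen {t : ℝ | ∃ x, (1 - t) * F x + t * G x < 0 ∧ p x} := by
    simp only [ofPred_exists, ofPred_and]
    refine isOpen_iUnion fun x => (isOpen_lt ?_ continuous_const).inter isOpen_const
    fun_prop
  -- For each `t` the combination is negative at some point, at which `F` or `G` is negative too.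
  -- The parameters of either kind form an open set; the two sets cover `[0, 1]`, hence they meet.
  obtain ⟨t, ht, ⟨x, hx, hFx⟩, ⟨y, hy, hGy⟩⟩ := isPreconnected_Icc (a := (0 : ℝ)) (b := 1)
    _ _ (hopen fun x => F x < 0) (hopen fun x => G x < 0)
    (fun t ht => by
      obtain ⟨x, hx⟩ := hcon t ht
      rcases lt_or_ge (F x) 0 with h | h
      · exact Or.inl ⟨x, hx, h⟩
      · refine Or.inr ⟨x, hx, ?_⟩
        by_contra hG
        nlinarith [mul_nonneg (sub_nonneg.2 ht.2) h, mul_nonneg ht.1 (not_lt.1 hG)])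
    (by
      obtain ⟨x, hx⟩ := hcon 0 (by simp)
      exact ⟨0, by simp, x, hx, by simpa using hx⟩)
    (by
      obtain ⟨x, hx⟩ := hcon 1 (by simp)
      exact ⟨1, by simp, x, hx, by simpa using hx⟩)
  exact not_combination_neg_of_max_nonneg hFG ht hx hFx hy hGy

/-- The quadratic form `h ↦ ‖A h‖ ^ 2`. -/
noncomputable def normSqForm {E W : Type*} [NormedAddCommGroup E] [InnerProductSpace ℝ E]
    [NormedAddCommGroup W] [InnerProductSpace ℝ W] (A : E →L[ℝ] W) : QuadraticForm ℝ E :=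
  (LinearMap.BilinMap.toQuadraticMap (innerₗ W)).comp (A : E →ₗ[ℝ] W)

@[simp]
theorem normSqForm_apply {E W : Type*} [NormedAddCommGroup E] [InnerProductSpace ℝ E]
    [NormedAddCommGroup W] [InnerProductSpace ℝ W] (A : E →L[ℝ] W) (h : E) :
    normSqForm A h = ‖A h‖ ^ 2 := by
  simp [normSqForm]

section Operators

variable {E W : Type*} [NormedAddCommGroup E] [InnerProductSpace ℝ E]
  [NormedAddCommGroup W] [InnerProductSpace ℝ W] {T : E →L[ℝ] E}

/-! ### Positive operators on real Hilbert spaces -/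

theorem inner_sq_le_of_isPositive (hT : T.IsPositive) (x y : E) :
    ⟪T x, y⟫_ℝ ^ 2 ≤ ⟪T x, x⟫_ℝ * ⟪T y, y⟫_ℝ := by
  have := LinearMap.BilinForm.apply_mul_apply_le_of_forall_zero_le
    ((innerₗ E).comp (T : E →ₗ[ℝ] E)) (fun x => hT.inner_nonneg_left x) x y
  have hs : ⟪T y, x⟫_ℝ = ⟪T x, y⟫_ℝ := by
    rw [hT.inner_left_eq_inner_right, real_inner_comm]
  simp only [LinearMap.comp_apply, innerₗ_apply_apply, ContinuousLinearMap.coe_coe, hs] at this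
  rwa [sq]

theorem apply_inverse_apply (hU : IsUnit T) (x : E) : T (Ring.inverse T x) = x :=
  congrArg (fun L : E →L[ℝ] E => L x) (Ring.mul_inverse_cancel T hU)

theorem isPositive_inverse (hT : T.IsPositive) (hU : IsUnit T) : (Ring.inverse T).IsPositive := by
  refine (ContinuousLinearMap.isPositive_iff _).2 ⟨fun x y => ?_, fun x => ?_⟩
  · calc ⟪Ring.inverse T x, y⟫_ℝ = ⟪Ring.inverse T x, T (Ring.inverse T y)⟫_ℝ := by
          rw [apply_inverse_apply hU]
      _ = ⟪x, Ring.inverse T y⟫_ℝ := by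
          rw [← hT.inner_left_eq_inner_right, apply_inverse_apply hU]
  · have := hT.inner_nonneg_right (Ring.inverse T x)
    rwa [apply_inverse_apply hU] at this

theorem abs_rayleighQuotient_of_isPositive (hT : T.IsPositive) (x : E) :
    |T.rayleighQuotient x| = T.rayleighQuotient x :=
  abs_of_nonneg (div_nonneg (hT.re_inner_nonneg_left x) (by positivity))

theorem norm_le_iff_inner_le {A : E →L[ℝ] E} (hA : A.IsPositive) {c : ℝ} (hc : 0 ≤ c) :
    ‖A‖ ≤ c ↔ ∀ z, ⟪A z, z⟫_ℝ ≤ c * ‖z‖ ^ 2 := by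
  refine ⟨fun h z => ?_, fun h => ?_⟩
  · calc ⟪A z, z⟫_ℝ ≤ ‖A z‖ * ‖z‖ := real_inner_le_norm _ _
      _ ≤ (c * ‖z‖) * ‖z‖ := by gcongr; exact A.le_of_opNorm_le h z
      _ = c * ‖z‖ ^ 2 := by ring
  · rw [A.norm_eq_iSup_rayleighQuotient hA.isSymmetric]
    refine ciSup_le fun x => ?_
    rw [abs_rayleighQuotient_of_isPositive hA]
    exact div_le_of_le_mul₀ (by positivity) hc (h x)

variable [CompleteSpace E]

theorem isUnit_of_coercive {c : ℝ} (hc : 0 < c)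
    (hT : ∀ h, c * ‖h‖ ^ 2 ≤ ⟪T h, h⟫_ℝ) : IsUnit T := by
  refine ContinuousLinearMap.isUnit_of_forall_le_norm_inner_map T (c := ⟨c, hc.le⟩) hc fun x => ?_
  calc ‖x‖ ^ 2 * c = c * ‖x‖ ^ 2 := mul_comm _ _
    _ ≤ ⟪T x, x⟫_ℝ := hT x
    _ ≤ ‖⟪T x, x⟫_ℝ‖ := le_abs_self _

/-- For a positive operator the convention `lambdaMax = 0` on the zero space agrees with the
norm. -/
theorem lambdaMax_eq_norm {A : E →L[ℝ] E} (hA : A.IsPositive) : lambdaMax A = ‖A‖ := by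
  rcases subsingleton_or_nontrivial E with hE | hE
  · have : Subsingleton (E →L[ℝ] E) := inferInstance
    simp [lambdaMax, spectrum.of_subsingleton, Subsingleton.elim A 0]
  have hmem : ‖A‖ ∈ spectrum ℝ A := by
    by_contra hn
    obtain ⟨ε, hε, hle⟩ :=
      A.rayleighQuotient_le_of_norm_mem_resolventSet (by simpa [spectrum] using hn)
    have h1 := A.norm_eq_iSup_rayleighQuotient hA.isSymmetric
    have h2 : ⨆ x, |A.rayleighQuotient x| ≤ ‖A‖ - ε := ciSup_le fun x => by
      rw [abs_rayleighQuotient_of_isPositive hA]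
      exact hle x
    linarith
  exact IsGreatest.csSup_eq ⟨hmem, fun μ hμ =>
    (le_abs_self μ).trans (spectrum.norm_le_norm_of_mem hμ)⟩

variable [CompleteSpace W]

/-- The largest spectral value of `Q T⁻¹ Q*` is the best constant `c` in `Q* Q ≤ c T`. -/
theorem lambdaMax_conj_inverse_le_iff (hT : T.IsPositive) (hU : IsUnit T) (Q : E →L[ℝ] W)
    {c : ℝ} (hc : 0 ≤ c) :
    lambdaMax (Q ∘L Ring.inverse T ∘L Q.adjoint) ≤ c ↔ ∀ h, ‖Q h‖ ^ 2 ≤ c * ⟪T h, h⟫_ℝ := by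
  have hA := (isPositive_inverse hT hU).conj_adjoint Q
  rw [lambdaMax_eq_norm hA, norm_le_iff_inner_le hA hc]
  -- The quadratic form of `Q T⁻¹ Q*` at `z` is that of `T` at `T⁻¹ Q* z`.
  have hform (z : W) : ⟪(Q ∘L Ring.inverse T ∘L Q.adjoint) z, z⟫_ℝ =
      ⟪T (Ring.inverse T (Q.adjoint z)), Ring.inverse T (Q.adjoint z)⟫_ℝ := by
    rw [apply_inverse_apply hU, ContinuousLinearMap.adjoint_inner_left, real_inner_comm]
    rfl
  constructor
  · intro h x
    have hz := h (Q x)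
    rw [hform] at hz
    have hcs := inner_sq_le_of_isPositive hT (Ring.inverse T (Q.adjoint (Q x))) x
    have hl : ⟪T (Ring.inverse T (Q.adjoint (Q x))), x⟫_ℝ = ‖Q x‖ ^ 2 := by
      rw [apply_inverse_apply hU, ContinuousLinearMap.adjoint_inner_left,
        real_inner_self_eq_norm_sq]
    rw [hl] at hcs
    have hp := hT.inner_nonneg_left x
    rcases (sq_nonneg ‖Q x‖).eq_or_lt with h0 | h0
    · rw [← h0]
      exact mul_nonneg hc hp
    · refine le_of_mul_le_mul_left ?_ h0
      nlinarith [mul_le_mul_of_nonneg_right hz hp]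
  · intro h z
    rw [hform]
    set k := Ring.inverse T (Q.adjoint z) with hk
    have hp := hT.inner_nonneg_left k
    have hl : ⟪T k, k⟫_ℝ = ⟪Q k, z⟫_ℝ := by
      rw [hk, apply_inverse_apply hU, ← hk, ContinuousLinearMap.adjoint_inner_left,
        real_inner_comm]
    have hcs := real_inner_le_norm (Q k) z
    rw [← hl] at hcs
    rcases hp.eq_or_lt with h0 | h0
    · rw [← h0]
      positivity
    · refine le_of_mul_le_mul_left ?_ h0
      calc ⟪T k, k⟫_ℝ * ⟪T k, k⟫_ℝ ≤ (‖Q k‖ * ‖z‖) * (‖Q k‖ * ‖z‖) :=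
            mul_self_le_mul_self hp hcs
        _ = ‖Q k‖ ^ 2 * ‖z‖ ^ 2 := by ring
        _ ≤ (c * ⟪T k, k⟫_ℝ) * ‖z‖ ^ 2 := by gcongr; exact h k
        _ = ⟪T k, k⟫_ℝ * (c * ‖z‖ ^ 2) := by ring

theorem lambdaMax_conj_inverse_nonneg (hT : T.IsPositive) (hU : IsUnit T) (Q : E →L[ℝ] W) :
    0 ≤ lambdaMax (Q ∘L Ring.inverse T ∘L Q.adjoint) := by
  rw [lambdaMax_eq_norm ((isPositive_inverse hT hU).conj_adjoint Q)]
  exact norm_nonneg _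

end Operators

section Recovery

variable {H X Y Z : Type*}
  [NormedAddCommGroup H] [InnerProductSpace ℝ H]
  [NormedAddCommGroup X] [InnerProductSpace ℝ X]
  [NormedAddCommGroup Y] [InnerProductSpace ℝ Y]
  [NormedAddCommGroup Z] [InnerProductSpace ℝ Z]
  {m : ℕ} {Q : H →L[ℝ] Z} {R : H →L[ℝ] X} {S : H →L[ℝ] Y}
  {Λ : H →L[ℝ] EuclideanSpace ℝ (Fin m)} {τ : ℝ}

/-! ### The lower bound for the radius and the duality of the program -/

/-- The points `h` and `-h` of the model set are not told apart by the observations. -/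
theorem ofReal_norm_le_radius {h : H} (hΛ : Λ h = 0) (hK : h ∈ modelSet R S) :
    ENNReal.ofReal ‖Q h‖ ≤ radius Q (modelSet R S) Λ := by
  refine le_iInf fun Δ => ?_
  have hK' : -h ∈ modelSet R S := by simpa [modelSet] using hK
  have h1 : ENNReal.ofReal ‖Q h - Δ 0‖ ≤ worstCaseError Q (modelSet R S) Λ Δ := by
    have := le_iSup₂ (f := fun f (_ : f ∈ modelSet R S) => ENNReal.ofReal ‖Q f - Δ (Λ f)‖) h hK
    rwa [hΛ] at this
  have h2 : ENNReal.ofReal ‖-Q h - Δ 0‖ ≤ worstCaseError Q (modelSet R S) Λ Δ := by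
    have := le_iSup₂ (f := fun f (_ : f ∈ modelSet R S) => ENNReal.ofReal ‖Q f - Δ (Λ f)‖) _ hK'
    rwa [map_neg, map_neg, hΛ, neg_zero] at this
  have h3 : ‖Q h‖ ≤ max ‖Q h - Δ 0‖ ‖-Q h - Δ 0‖ := by
    have h4 : ‖(Q h - Δ 0) - (-Q h - Δ 0)‖ = 2 * ‖Q h‖ := by
      rw [show (Q h - Δ 0) - (-Q h - Δ 0) = (2 : ℝ) • Q h by module, norm_smul]
      norm_num
    have h5 := norm_sub_le (Q h - Δ 0) (-Q h - Δ 0)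
    rcases le_total ‖Q h - Δ 0‖ ‖-Q h - Δ 0‖ with h6 | h6
    · rw [max_eq_right h6]; linarith
    · rw [max_eq_left h6]; linarith
  rcases le_max_iff.1 h3 with h4 | h4
  · exact (ENNReal.ofReal_le_ofReal h4).trans h1
  · exact (ENNReal.ofReal_le_ofReal h4).trans h2

/-- The squared errors `‖Q h‖ ^ 2` over the elements `h` of the model set in `ker Λ`. -/
def kernelValues (Q : H →L[ℝ] Z) (R : H →L[ℝ] X) (S : H →L[ℝ] Y)
    (Λ : H →L[ℝ] EuclideanSpace ℝ (Fin m)) : Set ℝ :=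
  {v | ∃ h : H, Λ h = 0 ∧ h ∈ modelSet R S ∧ ‖Q h‖ ^ 2 = v}

theorem zero_mem_kernelValues : (0 : ℝ) ∈ kernelValues Q R S Λ :=
  ⟨0, by simp, by simp [modelSet], by simp⟩

theorem bddAbove_kernelValues {δ : ℝ} (hδ : 0 < δ)
    (hRS : ∀ h : H, Λ h = 0 → δ * ‖h‖ ≤ max ‖R h‖ ‖S h‖) : BddAbove (kernelValues Q R S Λ) := by
  refine ⟨(‖Q‖ * δ⁻¹) ^ 2, ?_⟩
  rintro v ⟨h, h0, ⟨h1, h2⟩, rfl⟩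
  have h3 : ‖h‖ ≤ δ⁻¹ := by
    rw [← one_div, le_div_iff₀' hδ]
    exact (hRS h h0).trans (max_le h1 h2)
  gcongr
  exact Q.le_opNorm_of_le h3

/-- Weak duality. -/
theorem le_add_of_mem_feasibleSet {a b v : ℝ} (hab : (a, b) ∈ feasibleSet Q R S Λ)
    (hv : v ∈ kernelValues Q R S Λ) : v ≤ a + b := by
  obtain ⟨h, h0, ⟨h1, h2⟩, rfl⟩ := hv
  obtain ⟨ha, hb, hf⟩ := hab
  have hR : ‖R h‖ ^ 2 ≤ 1 := pow_le_one₀ (norm_nonneg _) h1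
  have hS : ‖S h‖ ^ 2 ≤ 1 := pow_le_one₀ (norm_nonneg _) h2
  have := hf h h0
  simp only at ha hb this
  nlinarith [mul_le_mul_of_nonneg_left hR ha, mul_le_mul_of_nonneg_left hS hb]

/-- By homogeneity, a bound on the model set extends to all of `ker Λ`. Coercivity serves to
exclude that `R h` and `S h` vanish together. -/
theorem norm_sq_le_sSup_mul_max {δ : ℝ} (hδ : 0 < δ)
    (hRS : ∀ h : H, Λ h = 0 → δ * ‖h‖ ≤ max ‖R h‖ ‖S h‖) {h : H} (h0 : Λ h = 0) :
    ‖Q h‖ ^ 2 ≤ sSup (kernelValues Q R S Λ) * max (‖R h‖ ^ 2) (‖S h‖ ^ 2) := by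
  rcases eq_or_ne h 0 with rfl | hne
  · simp
  set M := max ‖R h‖ ‖S h‖ with hM
  have hMpos : 0 < M := (mul_pos hδ (norm_pos_iff.2 hne)).trans_le (hRS h h0)
  have hmem : ‖Q (M⁻¹ • h)‖ ^ 2 ∈ kernelValues Q R S Λ := by
    refine ⟨M⁻¹ • h, by simp [h0], ⟨?_, ?_⟩, rfl⟩
    all_goals
      rw [map_smul, norm_smul, Real.norm_of_nonneg (by positivity), inv_mul_le_one₀ hMpos]
    · exact le_max_left _ _
    · exact le_max_right _ _
  have hle := le_csSup (bddAbove_kernelValues hδ hRS) hmem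
  rw [map_smul, norm_smul, Real.norm_of_nonneg (by positivity), mul_pow, inv_pow,
    inv_mul_le_iff₀ (by positivity)] at hle
  have hM2 : M ^ 2 ≤ max (‖R h‖ ^ 2) (‖S h‖ ^ 2) := by
    rcases max_choice ‖R h‖ ‖S h‖ with h1 | h1
    · rw [hM, h1]; exact le_max_left _ _
    · rw [hM, h1]; exact le_max_right _ _
  have hv : 0 ≤ sSup (kernelValues Q R S Λ) :=
    le_csSup (bddAbove_kernelValues hδ hRS) zero_mem_kernelValues
  nlinarith [mul_le_mul_of_nonneg_left hM2 hv]

/-- Strong duality: the constraints `a ‖R h‖² + b ‖S h‖² ≥ ‖Q h‖²` are met on `ker Λ` by a pair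
with `a + b` equal to the supremum of `‖Q h‖²` over the model set in `ker Λ`. -/
theorem exists_norm_sq_le_sSup_mul {δ : ℝ} (hδ : 0 < δ)
    (hRS : ∀ h : H, Λ h = 0 → δ * ‖h‖ ≤ max ‖R h‖ ‖S h‖) :
    ∃ t ∈ Icc (0 : ℝ) 1, ∀ h : H, Λ h = 0 →
      ‖Q h‖ ^ 2 ≤ sSup (kernelValues Q R S Λ) * ((1 - t) * ‖R h‖ ^ 2 + t * ‖S h‖ ^ 2) := by
  set v := sSup (kernelValues Q R S Λ) with hv
  obtain ⟨t, ht, hn⟩ := exists_combination_nonneg_of_max_nonneg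
    (F := v • normSqForm (restrict Λ R) - normSqForm (restrict Λ Q))
    (G := v • normSqForm (restrict Λ S) - normSqForm (restrict Λ Q))
    (fun h => by
      have hle := norm_sq_le_sSup_mul_max (Q := Q) hδ hRS (h := (h : H)) h.2
      rw [← hv] at hle
      rcases max_choice (‖R h‖ ^ 2) (‖S h‖ ^ 2) with h1 | h1 <;> rw [h1] at hle
      · exact le_max_of_le_left (by simpa [restrict] using hle)
      · exact le_max_of_le_right (by simpa [restrict] using hle))
  refine ⟨t, ht, fun h h0 => ?_⟩
  have := hn ⟨h, h0⟩
  simp only [restrict, sub_apply, smul_apply, normSqForm_apply,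
    ContinuousLinearMap.comp_apply, Submodule.subtypeL_apply, smul_eq_mul] at this
  linarith

/-! ### The pencil and the objective -/

variable [CompleteSpace H] [CompleteSpace X] [CompleteSpace Y] [CompleteSpace Z]

theorem inner_pencil (h k : nullSpace Λ) : ⟪pencil R S Λ τ h, k⟫_ℝ =
    (1 - τ) * ⟪R h, R k⟫_ℝ + τ * ⟪S h, S k⟫_ℝ := by
  simp [pencil, inner_add_left, inner_smul_left, ContinuousLinearMap.adjoint_inner_left, restrict,
    -Submodule.coe_inner]

theorem inner_pencil_self (h : nullSpace Λ) : ⟪pencil R S Λ τ h, h⟫_ℝ =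
    (1 - τ) * ‖R h‖ ^ 2 + τ * ‖S h‖ ^ 2 := by
  rw [inner_pencil, real_inner_self_eq_norm_sq, real_inner_self_eq_norm_sq]

theorem isPositive_pencil (hτ : τ ∈ Icc (0 : ℝ) 1) : (pencil R S Λ τ).IsPositive :=
  (((restrict Λ R).isPositive_adjoint_comp_self).smul_of_nonneg (sub_nonneg.2 hτ.2)).add
    (((restrict Λ S).isPositive_adjoint_comp_self).smul_of_nonneg hτ.1)

theorem Ioo_subset_domain {δ : ℝ} (hδ : 0 < δ)
    (hRS : ∀ h : H, Λ h = 0 → δ * ‖h‖ ≤ max ‖R h‖ ‖S h‖) : Ioo (0 : ℝ) 1 ⊆ domain R S Λ := by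
  rintro τ ⟨h0, h1⟩
  have h1' : 0 < 1 - τ := sub_pos.2 h1
  refine ⟨⟨h0.le, h1.le⟩, isUnit_of_coercive (c := min (1 - τ) τ * δ ^ 2) (by positivity) ?_⟩
  intro h
  rw [inner_pencil_self]
  have hh : δ * ‖h‖ ≤ max ‖R h‖ ‖S h‖ := hRS h h.2
  have hR : 0 ≤ (1 - τ) * ‖R h‖ ^ 2 := by positivity
  have hS : 0 ≤ τ * ‖S h‖ ^ 2 := by positivity
  rw [mul_assoc, ← mul_pow]
  rcases le_max_iff.1 hh with hm | hm
  · calc min (1 - τ) τ * (δ * ‖h‖) ^ 2 ≤ (1 - τ) * ‖R h‖ ^ 2 := by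
          gcongr
          exact min_le_left _ _
      _ ≤ _ := by linarith
  · calc min (1 - τ) τ * (δ * ‖h‖) ^ 2 ≤ τ * ‖S h‖ ^ 2 := by
          gcongr
          exact min_le_right _ _
      _ ≤ _ := by linarith

theorem objective_nonneg (hτ : τ ∈ domain R S Λ) : 0 ≤ objective Q R S Λ τ :=
  lambdaMax_conj_inverse_nonneg (isPositive_pencil hτ.1) hτ.2 _

theorem objective_le_iff (hτ : τ ∈ domain R S Λ) {c : ℝ} (hc : 0 ≤ c) :
    objective Q R S Λ τ ≤ c ↔
      ∀ h : H, Λ h = 0 → ‖Q h‖ ^ 2 ≤ c * ((1 - τ) * ‖R h‖ ^ 2 + τ * ‖S h‖ ^ 2) := by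
  rw [objective, lambdaMax_conj_inverse_le_iff (isPositive_pencil hτ.1) hτ.2 _ hc]
  simp only [inner_pencil_self]
  exact ⟨fun h x hx => h ⟨x, hx⟩, fun h x => h x x.2⟩

/-- The pair `(1 - τ, τ)`, scaled by the objective, is feasible. -/
theorem mem_feasibleSet_of_mem_domain (hτ : τ ∈ domain R S Λ) :
    ((1 - τ) * objective Q R S Λ τ, τ * objective Q R S Λ τ) ∈ feasibleSet Q R S Λ := by
  have h0 := objective_nonneg (Q := Q) hτ
  refine ⟨mul_nonneg (sub_nonneg.2 hτ.1.2) h0, mul_nonneg hτ.1.1 h0, fun h hh => ?_⟩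
  have := (objective_le_iff (Q := Q) hτ h0).1 le_rfl h hh
  simp only
  linarith

/-! ### The upper bound for the radius -/

/-- Each `f` is congruent modulo `ker Λ` to an element `u` which is orthogonal to `ker Λ` for the
semi-inner product `(1 - τ) ⟪R ·, R ·⟫ + τ ⟪S ·, S ·⟫`. -/
theorem exists_orthogonal_representative (hU : IsUnit (pencil R S Λ τ)) (f : H) :
    ∃ u : H, Λ u = Λ f ∧
      ∀ k : H, Λ k = 0 → (1 - τ) * ⟪R u, R k⟫_ℝ + τ * ⟪S u, S k⟫_ℝ = 0 := by
  set w : nullSpace Λ :=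
    (1 - τ) • (restrict Λ R).adjoint (R f) + τ • (restrict Λ S).adjoint (S f) with hw
  set p := Ring.inverse (pencil R S Λ τ) w with hp
  have hp0 : Λ (p : H) = 0 := p.2
  refine ⟨f - p, by rw [map_sub, hp0, sub_zero], fun k hk => ?_⟩
  have h1 : ⟪pencil R S Λ τ p, (⟨k, hk⟩ : nullSpace Λ)⟫_ℝ = ⟪w, (⟨k, hk⟩ : nullSpace Λ)⟫_ℝ := by
    rw [hp, apply_inverse_apply hU]
  have h2 : ⟪w, (⟨k, hk⟩ : nullSpace Λ)⟫_ℝ = (1 - τ) * ⟪R f, R k⟫_ℝ + τ * ⟪S f, S k⟫_ℝ := by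
    simp [hw, inner_add_left, inner_smul_left, ContinuousLinearMap.adjoint_inner_left, restrict,
      -Submodule.coe_inner]
  rw [inner_pencil, h2] at h1
  simp only [map_sub, inner_sub_left]
  linarith

/-- The regularized recovery map, which sends `Λ f` to `Q u` for the orthogonal representative `u`
of `f`, has squared worst-case error at most the objective. -/
theorem radius_sq_le_objective (hΛ : Function.Surjective Λ) (hτ : τ ∈ domain R S Λ) :
    radius Q (modelSet R S) Λ ^ 2 ≤ ENNReal.ofReal (objective Q R S Λ τ) := by
  have hex (y : EuclideanSpace ℝ (Fin m)) : ∃ u : H, Λ u = y ∧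
      ∀ k : H, Λ k = 0 → (1 - τ) * ⟪R u, R k⟫_ℝ + τ * ⟪S u, S k⟫_ℝ = 0 := by
    obtain ⟨f, rfl⟩ := hΛ y
    exact exists_orthogonal_representative hτ.2 f
  choose u hu huo using hex
  have h0 := objective_nonneg (Q := Q) hτ
  set c := objective Q R S Λ τ with hc
  have hr : radius Q (modelSet R S) Λ ≤ ENNReal.ofReal (Real.sqrt c) := by
    refine (iInf_le _ fun y => Q (u y)).trans (iSup₂_le fun f hf => ?_)
    refine ENNReal.ofReal_le_ofReal (Real.le_sqrt_of_sq_le ?_)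
    set k := f - u (Λ f) with hk
    have hk0 : Λ k = 0 := by rw [hk, map_sub, hu, sub_self]
    have hfk : f = u (Λ f) + k := by rw [hk]; abel
    have hle := (objective_le_iff (Q := Q) hτ h0).1 hc.symm.le k hk0
    have horth := huo (Λ f) k hk0
    have hR : ‖R f‖ ^ 2 = ‖R (u (Λ f))‖ ^ 2 + 2 * ⟪R (u (Λ f)), R k⟫_ℝ + ‖R k‖ ^ 2 := by
      conv_lhs => rw [hfk, map_add, norm_add_sq_real]
    have hS : ‖S f‖ ^ 2 = ‖S (u (Λ f))‖ ^ 2 + 2 * ⟪S (u (Λ f)), S k⟫_ℝ + ‖S k‖ ^ 2 := by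
      conv_lhs => rw [hfk, map_add, norm_add_sq_real]
    have h1τ : 0 ≤ 1 - τ := sub_nonneg.2 hτ.1.2
    have hR1 : (1 - τ) * ‖R f‖ ^ 2 ≤ (1 - τ) * 1 :=
      mul_le_mul_of_nonneg_left (pow_le_one₀ (norm_nonneg _) hf.1) h1τ
    have hS1 : τ * ‖S f‖ ^ 2 ≤ τ * 1 :=
      mul_le_mul_of_nonneg_left (pow_le_one₀ (norm_nonneg _) hf.2) hτ.1.1
    have hR2 : 0 ≤ (1 - τ) * ‖R (u (Λ f))‖ ^ 2 := by positivity
    have hS2 : 0 ≤ τ * ‖S (u (Λ f))‖ ^ 2 := mul_nonneg hτ.1.1 (by positivity)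
    -- Pythagoras for the semi-inner product
    have hpyth : (1 - τ) * ‖R k‖ ^ 2 + τ * ‖S k‖ ^ 2 ≤ 1 := by
      rw [hR] at hR1
      rw [hS] at hS1
      linarith
    rw [← map_sub, ← hk]
    exact hle.trans (mul_le_of_le_one_right h0 hpyth)
  calc radius Q (modelSet R S) Λ ^ 2 ≤ ENNReal.ofReal (Real.sqrt c) ^ 2 := by gcongr
    _ = ENNReal.ofReal c := by
      rw [← ENNReal.ofReal_pow (Real.sqrt_nonneg _), Real.sq_sqrt h0]

/-! ### The infimum of the objective -/

theorem sSup_kernelValues_le_objective (hτ : τ ∈ domain R S Λ) :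
    sSup (kernelValues Q R S Λ) ≤ objective Q R S Λ τ :=
  csSup_le ⟨0, zero_mem_kernelValues⟩ fun v hv => by
    have := le_add_of_mem_feasibleSet (mem_feasibleSet_of_mem_domain (Q := Q) hτ) hv
    linarith

/-- The optimal parameter `t` of the strong duality may be an endpoint of `[0, 1]` outside of the
domain; it is approached by parameters of the open interval. -/
theorem isGLB_objective {δ : ℝ} (hδ : 0 < δ)
    (hRS : ∀ h : H, Λ h = 0 → δ * ‖h‖ ≤ max ‖R h‖ ‖S h‖) :
    IsGLB (objective Q R S Λ '' domain R S Λ) (sSup (kernelValues Q R S Λ)) := by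
  refine ⟨forall_mem_image.2 fun τ hτ => sSup_kernelValues_le_objective hτ, fun c hc => ?_⟩
  have hv : 0 ≤ sSup (kernelValues Q R S Λ) :=
    le_csSup (bddAbove_kernelValues hδ hRS) zero_mem_kernelValues
  obtain ⟨t, ⟨ht0, ht1⟩, ht⟩ := exists_norm_sq_le_sSup_mul (Q := Q) hδ hRS
  set v := sSup (kernelValues Q R S Λ)
  -- The pencil at the parameter below dominates `1 - s` times the pencil at `t`.
  have hs : ∀ s ∈ Ioo (0 : ℝ) 1, (1 - s) * c ≤ v := by
    rintro s ⟨hs0, hs1⟩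
    have h1s : 0 < 1 - s := sub_pos.2 hs1
    have hτ : (1 - s) * t + s / 2 ∈ domain R S Λ :=
      Ioo_subset_domain hδ hRS ⟨by nlinarith, by nlinarith⟩
    have hg : objective Q R S Λ ((1 - s) * t + s / 2) ≤ v / (1 - s) := by
      refine (objective_le_iff hτ (div_nonneg hv h1s.le)).2 fun h h0 => (ht h h0).trans ?_
      have hid : v * ((1 - t) * ‖R h‖ ^ 2 + t * ‖S h‖ ^ 2) = v / (1 - s) *
          ((1 - s) * ((1 - t) * ‖R h‖ ^ 2 + t * ‖S h‖ ^ 2)) := by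
        field_simp
      rw [hid]
      refine mul_le_mul_of_nonneg_left ?_ (div_nonneg hv h1s.le)
      nlinarith [mul_nonneg hs0.le (sq_nonneg ‖R h‖), mul_nonneg hs0.le (sq_nonneg ‖S h‖)]
    have := (hc (mem_image_of_mem _ hτ)).trans hg
    rwa [le_div_iff₀' h1s] at this
  refine le_of_tendsto (f := fun s : ℝ => (1 - s) * c) (x := nhdsWithin 0 (Ioi 0)) ?_
    (Filter.eventually_of_mem (Ioo_mem_nhdsGT one_pos) hs)
  have : Continuous fun s : ℝ => (1 - s) * c := by fun_prop
  simpa using (this.tendsto 0).mono_left nhdsWithin_le_nhds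

theorem radius_sq_eq {δ : ℝ} (hδ : 0 < δ)
    (hRS : ∀ h : H, Λ h = 0 → δ * ‖h‖ ≤ max ‖R h‖ ‖S h‖) (hΛ : Function.Surjective Λ) :
    radius Q (modelSet R S) Λ ^ 2 = ENNReal.ofReal (sSup (kernelValues Q R S Λ)) := by
  have hdom : (1 / 2 : ℝ) ∈ domain R S Λ := Ioo_subset_domain hδ hRS (by norm_num)
  have htop : radius Q (modelSet R S) Λ ≠ ⊤ := by
    intro h
    have := radius_sq_le_objective (Q := Q) hΛ hdom
    rw [h] at this
    simp at this
  have hle {τ : ℝ} (hτ : τ ∈ domain R S Λ) :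
      (radius Q (modelSet R S) Λ).toReal ^ 2 ≤ objective Q R S Λ τ := by
    rw [← ENNReal.toReal_pow]
    exact ENNReal.toReal_le_of_le_ofReal (objective_nonneg hτ) (radius_sq_le_objective hΛ hτ)
  rw [← ENNReal.ofReal_toReal htop, ← ENNReal.ofReal_pow ENNReal.toReal_nonneg]
  congr 1
  refine le_antisymm ((isGLB_objective hδ hRS).2 (forall_mem_image.2 fun τ hτ => hle hτ)) ?_
  refine csSup_le ⟨0, zero_mem_kernelValues⟩ ?_
  rintro v ⟨h, h0, hK, rfl⟩
  gcongr
  exact (ENNReal.ofReal_le_iff_le_toReal htop).1 (ofReal_norm_le_radius h0 hK)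

end Recovery

end OptimalRecovery

theorem mainTheorem6 {H X Y Z : Type*}
    [NormedAddCommGroup H] [InnerProductSpace ℝ H] [CompleteSpace H]
    [NormedAddCommGroup X] [InnerProductSpace ℝ X] [CompleteSpace X]
    [NormedAddCommGroup Y] [InnerProductSpace ℝ Y] [CompleteSpace Y]
    [NormedAddCommGroup Z] [InnerProductSpace ℝ Z] [CompleteSpace Z]
    {m : ℕ} (Q : H →L[ℝ] Z) (R : H →L[ℝ] X) (S : H →L[ℝ] Y)
    (Λ : H →L[ℝ] EuclideanSpace ℝ (Fin m)) (_hΛ : Function.Surjective Λ)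
    (_hRS : ∃ δ : ℝ, 0 < δ ∧ ∀ h : H, Λ h = 0 → δ * ‖h‖ ≤ max ‖R h‖ ‖S h‖) :
    Ioo (0 : ℝ) 1 ⊆ OptimalRecovery.domain R S Λ ∧
    ∃ lam : ℝ, 0 ≤ lam ∧
      IsGLB (OptimalRecovery.objective Q R S Λ '' OptimalRecovery.domain R S Λ) lam ∧
      OptimalRecovery.radius Q (OptimalRecovery.modelSet R S) Λ ^ 2 = ENNReal.ofReal lam ∧
      (OptimalRecovery.domain R S Λ = Icc (0 : ℝ) 1 →
        IsLeast (OptimalRecovery.objective Q R S Λ '' Icc (0 : ℝ) 1) lam) ∧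
      ∀ τ ∈ Ioo (0 : ℝ) 1,
        IsMinOn (OptimalRecovery.objective Q R S Λ) (OptimalRecovery.domain R S Λ) τ →
          OptimalRecovery.IsProgramMinimizer Q R S Λ ((1 - τ) * lam) (τ * lam) := by
  obtain ⟨δ, hδ, hRS⟩ := _hRS
  have hglb := OptimalRecovery.isGLB_objective (Q := Q) hδ hRS
  have hv := le_csSup (OptimalRecovery.bddAbove_kernelValues (Q := Q) hδ hRS)
    OptimalRecovery.zero_mem_kernelValues
  refine ⟨OptimalRecovery.Ioo_subset_domain hδ hRS, _, hv, hglb,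
    OptimalRecovery.radius_sq_eq hδ hRS _hΛ, fun hD => ?_, fun τ _ hmin => ?_⟩
  · obtain ⟨t, ht, hle⟩ := OptimalRecovery.exists_norm_sq_le_sSup_mul (Q := Q) hδ hRS
    rw [← hD] at ht ⊢
    exact ⟨⟨t, ht, ((OptimalRecovery.objective_le_iff ht hv).2 hle).antisymm
      (OptimalRecovery.sSup_kernelValues_le_objective ht)⟩, hglb.1⟩
  · have hτ := OptimalRecovery.Ioo_subset_domain hδ hRS ‹τ ∈ Ioo (0 : ℝ) 1›
    have heq : OptimalRecovery.objective Q R S Λ τ =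
        sSup (OptimalRecovery.kernelValues Q R S Λ) :=
      le_antisymm (hglb.2 (forall_mem_image.2 fun σ hσ => hmin hσ))
        (OptimalRecovery.sSup_kernelValues_le_objective hτ)
    have hfeas := OptimalRecovery.mem_feasibleSet_of_mem_domain (Q := Q) hτ
    rw [heq] at hfeas
    refine ⟨hfeas, fun p hp => ?_⟩
    have hsum : sSup (OptimalRecovery.kernelValues Q R S Λ) ≤ p.1 + p.2 :=
      csSup_le ⟨0, OptimalRecovery.zero_mem_kernelValues⟩ fun v hv' =>
        OptimalRecovery.le_add_of_mem_feasibleSet hp hv'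
    simp only [mem_ofPred_eq]
    linarith
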